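/- All graphs $F,H,G,\Gamma,T$ are finite and simple. Write $H\to F$ if there is a homomorphism from $H$ to $F$, and say that a graph $\Gamma$ is $F$-hom-free if $F\not\to\Gamma$. A map $V(G)\to V(\Gamma)$ is an $\varepsilon$-approximate homomorphism if it maps all but at most $\varepsilon|V(G)|^2$ edges of $G$ to edges of $\Gamma$. For graphs $H\to F$ and $\varepsilon>0$, let $M_{F,H}(\varepsilon)$ be the smallest $M$ such that every $H$-hom-free graph has an $\varepsilon$-approximate homomorphism to an $F$-hom-free graph on at most $M$ vertices. A copy of $F$ in $G$ is a subgraph of $G$ isomorphic to $F$. An $F$-forest is a graph that can be obtained from the empty graph by repeatedly adding a copy of $F$ with at least $|V(F)|-1$ new vertices (so the new copy shares at most one vertex with the current graph). Let $\Delta$ be the maximum degree of $F$; for every $v\in V(F)$ fix an ordering of the edges at $v$ and label them $(v,1),\dots,(v,\deg v)$, so that each edge gets one label from each of its endpoints; for every copy of $F$ in a graph fix an isomorphism from $F$ to the copy, which transfers the labels to the copy. For a graph $T$ in which every edge lies in a unique copy of $F$ (such as any $F$-forest, if $F$ is $2$-connected), let $F_1,\dots,F_m$ be the copies of $F$ in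 $T$, and let $T^\star$ be the graph with vertex set $V(T)\times\{1,\dots,\Delta\}^m$ in which, for every edge $uv$ of $T$, with $F_k$ the copy that contains it and $(u,i)$, $(v,j)$ its labels in $F_k$, all vertices $(u,\mathbf x)$ and $(v,\mathbf y)$ with $\mathbf x_k=i$ and $\mathbf y_k=j$ are joined; there are no other edges. **Theorem.** Let $F,H$ be graphs with $H\to F$, where $F$ is $2$-connected (it has at least three vertices, is connected, and remains connected after the deletion of any one vertex), and suppose that $H$ is not homomorphic to $T^\star$ for any $F$-forest $T$ with $T\to F$. Then there is a constant $c>0$ depending only on $F$ and $H$ such that, for every sufficiently small $\varepsilon>0$, $$M_{F,H}(\varepsilon)\ \ge\ 2^{(1/\varepsilon)^{c}}.$$ -/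

import Mathlib

open scoped ENNReal

namespace AsymHom

/-- A finite graph is 2-connected if it has at least three vertices, is connected, and stays
connected after the deletion of any one vertex. -/
def TwoConnected {V : Type*} [Fintype V] (F : SimpleGraph V) : Prop :=
  3 ≤ Fintype.card V ∧ F.Connected ∧ ∀ v : V, (F.induce {v}ᶜ).Connected

/-- `G` is `F`-hom-free if there is no homomorphism from `F` to `G`. -/
def HomFree {V U : Type*} (F : SimpleGraph V) (G : SimpleGraph U) : Prop :=
  IsEmpty (F →g G)

/-- `f : V(G) → V(Γ)` is an `ε`-approximate homomorphism if all but at most `ε |G|²` edges of `G`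
are mapped to edges of `Γ`. -/
def IsApproxHom {U X : Type*} (G : SimpleGraph U) (Γ : SimpleGraph X) (ε : ℝ) (f : U → X) :
    Prop :=
  (({e | e ∈ G.edgeSet ∧ e.map f ∉ Γ.edgeSet}.ncard : ℕ) : ℝ) ≤ ε * (Nat.card U : ℝ) ^ 2

/-- Every finite `H`-hom-free graph has an `ε`-approximate homomorphism to an `F`-hom-free graph
on at most `M` vertices. -/
def ApproxHomBound {V W : Type*} (F : SimpleGraph V) (H : SimpleGraph W) (ε : ℝ) (M : ℕ) : Prop :=
  ∀ (U : Type) [Finite U] (G : SimpleGraph U), HomFree H G →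
    ∃ (k : ℕ) (Γ : SimpleGraph (Fin k)) (f : U → Fin k),
      k ≤ M ∧ HomFree F Γ ∧ IsApproxHom G Γ ε f

/-- The function `M_{F,H}(ε)`: the smallest `M` such that every `H`-hom-free graph has an
`ε`-approximate homomorphism to an `F`-hom-free graph on at most `M` vertices
(with the convention that it is `⊤` if there is no such `M`). -/
noncomputable def approxHomNumber {V W : Type*} (F : SimpleGraph V) (H : SimpleGraph W) (ε : ℝ) :
    ℕ∞ :=
  ⨅ (M : ℕ) (_ : ApproxHomBound F H ε M), (M : ℕ∞)

/-- The copies of `F` in `G`: the subgraphs of `G` that are isomorphic to `F`. -/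
abbrev FCopy {V U : Type*} (F : SimpleGraph V) (G : SimpleGraph U) : Type _ :=
  {C : G.Subgraph // Nonempty (F ≃g C.coe)}

/-- A choice, for every vertex `v` of `F`, of an ordering of the edges of `F` at `v`. The edge `vw`
is given by its other endpoint `w`; labels run from `0` to `deg v - 1`. -/
abbrev EdgeOrdering {V : Type*} [Fintype V] (F : SimpleGraph V) [DecidableRel F.Adj] : Type _ :=
  ∀ v : V, F.neighborSet v ≃ Fin (F.degree v)

/-- The graph `G⋆`. Its vertices are the pairs `(u, x)` with `u` a vertex of `G` and `x` a vector
indexed by the copies of `F` in `G`, with entries in a set of size the maximum degree of `F`.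
For every edge `uv` of `G`, which lies in a copy `C` of `F`, and has labels `(u, i)` and `(v, j)`
as an edge of `C`, all `(u, x)` with `x C = i` are joined to all `(v, y)` with `y C = j`.
The copy `C` receives its labels from the edge ordering `o` of `F` through the isomorphism
`iso C`. (The construction is meant for graphs `G` all of whose edges are in a unique copy
of `F`.) -/
def starGraph {V U : Type*} [Fintype V] (F : SimpleGraph V) [DecidableRel F.Adj]
    (o : EdgeOrdering F) (G : SimpleGraph U) (iso : ∀ C : FCopy F G, F ≃g C.1.coe) :
    SimpleGraph (U × (FCopy F G → Fin F.maxDegree)) where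
  Adj p q := ∃ (C : FCopy F G) (a b : V) (h : F.Adj a b),
    (iso C a : U) = p.1 ∧ (iso C b : U) = q.1 ∧
      (p.2 C : ℕ) = (o a ⟨b, h⟩ : ℕ) ∧ (q.2 C : ℕ) = (o b ⟨a, h.symm⟩ : ℕ)
  symm := by
    refine ⟨?_⟩
    rintro p q ⟨C, a, b, h, h1, h2, h3, h4⟩
    exact ⟨C, b, a, h.symm, h2, h1, h4, h3⟩
  loopless := by
    refine ⟨?_⟩
    rintro p ⟨C, a, b, h, h1, h2, -, -⟩
    exact h.ne ((iso C).injective (Subtype.ext (h1.trans h2.symm)))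

/-- `FForestOn F S T`: the graph with vertex set `S` and the edges of `T` is obtained from the empty
graph by repeatedly adding a copy of `F` that shares at most one vertex with the current graph
(equivalently, has at least `|V(F)| - 1` new vertices). -/
inductive FForestOn {V U : Type*} (F : SimpleGraph V) : Set U → SimpleGraph U → Prop
  | empty : FForestOn F ∅ ⊥
  | add (S : Set U) (T : SimpleGraph U) (j : V ↪ U) (hT : FForestOn F S T)
      (hj : (S ∩ Set.range j).Subsingleton) : FForestOn F (S ∪ Set.range j) (T ⊔ F.map j)

/-- `T` is an `F`-forest. -/
def IsFForest {V U : Type*} (F : SimpleGraph V) (T : SimpleGraph U) : Prop :=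
  FForestOn F Set.univ T

end AsymHom

/-!
The graph that needs a large target is a star graph. Take a family of copies of `F`, each with one
vertex in every part of a vertex set `V(F) × [n]`, such that the copies form a hypergraph without
short Berge cycles, and let `G` be the star of this family (`familyStar`).

*`G` is `H`-hom-free.* A homomorphism from `H` to `G` uses at most `|V(H)|²` of the copies. These
form an `F`-forest `T`, which maps to `F` by the projection `V(F) × [n] → V(F)`, and the
homomorphism induces one from `H` to `T⋆`, contrary to the hypothesis
(`exists_forest_of_hom_familyStar`). The isomorphisms that label the copies in `T⋆` are not
under control, but two choices differ by automorphisms of `F`, which only permute the labels at each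
vertex (`nonempty_familyStar_hom`).

*`G` has no good approximate homomorphism to a small `F`-hom-free graph `Γ`.* Such a map colours the
cube at each vertex of the family. A colour class of density `p` in a cube has all values of a
coordinate well represented at all but `O(log (1 / p))` coordinates (`card_unbalanced_le`). If a
vertex lies in many more copies than the logarithm of `|V(Γ)|`, then for a typical copy of `F` and
random points in the cubes at its vertices, the colour classes of these points are balanced at
the coordinate of the copy. Since the colours are not a homomorphic image of `F` in `Γ`, some edge
of `F` goes to a non-edge of `Γ`, and balance makes this cost a positive proportion of the
edges of `G` that come from the copy (`exists_adj_card_lost`, `card_le_of_isApproxHom`).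

*Dense families exist.* A greedy argument gives a family with about `D n` copies, maximum degree
`D`, and no short cycles, where `n` is a power of `D` (`exists_sparse_family`). The absence of short
cycles is encoded by a sparsity condition on the number of spanned vertices (`SparseUpTo`). With
`ε` slightly below `D / n` up to constants, the number of vertices of `Γ` is exponential in `D`,
a power of `1 / ε`.
-/

namespace AsymHom

/-! ### Sparse hypergraphs -/

section Hypergraph

open Finset

variable {ι X : Type*} [DecidableEq X]

/-- A family `𝓗` of hyperedges is `g`-sparse (for uniformity `r`) if any `s` of them with
`1 ≤ s ≤ g` span at least `(r - 1) s + 1` vertices, as the edges of a hyperforest do. For an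
`r`-uniform family this says that there is no Berge cycle of length at most `g`. -/
def SparseUpTo (E : ι → Finset X) (r g : ℕ) (𝓗 : Finset ι) : Prop :=
  ∀ 𝓢 ⊆ 𝓗, 𝓢.Nonempty → #𝓢 ≤ g → (r - 1) * #𝓢 + 1 ≤ #(𝓢.biUnion E)

/-- The set of vertices that can be reached from `A` by walking along at most `k` hyperedges
of `𝓗`. -/
def reach (E : ι → Finset X) (𝓗 : Finset ι) : ℕ → Finset X → Finset X
  | 0, A => A
  | k + 1, A => reach E 𝓗 k A ∪ {C ∈ 𝓗 | ¬ Disjoint (E C) (reach E 𝓗 k A)}.biUnion E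

lemma reach_mono (E : ι → Finset X) (𝓗 : Finset ι) (A : Finset X) :
    Monotone fun k ↦ reach E 𝓗 k A :=
  monotone_nat_of_le_succ fun _ ↦ subset_union_left

lemma mem_reach_succ {E : ι → Finset X} {𝓗 : Finset ι} {A : Finset X} {k : ℕ} {C : ι}
    (hC : C ∈ 𝓗) {x y : X} (hx : x ∈ E C) (hy : y ∈ E C) (h : x ∈ reach E 𝓗 k A) :
    y ∈ reach E 𝓗 (k + 1) A :=
  mem_union_right _ (mem_biUnion.2
    ⟨C, mem_filter.2 ⟨hC, not_disjoint_iff.2 ⟨x, hx, h⟩⟩, hy⟩)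

lemma mem_reach_of_mem_reach {E : ι → Finset X} {𝓗 : Finset ι} {A : Finset X} {y : X} :
    ∀ {l k : ℕ} {z : X}, z ∈ reach E 𝓗 l {y} → z ∈ reach E 𝓗 k A → y ∈ reach E 𝓗 (k + l) A
  | 0, k, z, h, h' => by
    rw [reach, mem_singleton] at h
    exact h ▸ h'
  | l + 1, k, z, h, h' => by
    rw [reach, mem_union, mem_biUnion] at h
    rcases h with h | ⟨C, hC, hz⟩
    · exact reach_mono E 𝓗 A (by omega) (mem_reach_of_mem_reach h h')
    · rw [mem_filter, not_disjoint_iff] at hC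
      obtain ⟨hC, w, hwC, hw⟩ := hC
      have := mem_reach_of_mem_reach hw (mem_reach_succ hC hz hwC h')
      rwa [show k + (l + 1) = k + 1 + l by ring]

lemma card_reach_le {E : ι → Finset X} {𝓗 : Finset ι} {r D : ℕ} (hr : ∀ C, #(E C) = r)
    (hD : ∀ x, #{C ∈ 𝓗 | x ∈ E C} ≤ D) (A : Finset X) (k : ℕ) :
    #(reach E 𝓗 k A) ≤ #A * (1 + r * D) ^ k := by
  classical
  induction k with
  | zero => simp [reach]
  | succ k ih =>
    have h1 : #{C ∈ 𝓗 | ¬ Disjoint (E C) (reach E 𝓗 k A)} ≤ #(reach E 𝓗 k A) * D := by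
      calc _ ≤ #((reach E 𝓗 k A).biUnion fun x ↦ {C ∈ 𝓗 | x ∈ E C}) := by
            refine card_le_card fun C hC ↦ ?_
            rw [mem_filter, not_disjoint_iff] at hC
            obtain ⟨hC, x, hx, hx'⟩ := hC
            exact mem_biUnion.2 ⟨x, hx', mem_filter.2 ⟨hC, hx⟩⟩
        _ ≤ _ := card_biUnion_le_card_mul _ _ _ fun x _ ↦ hD x
    have h2 := card_biUnion_le_card_mul {C ∈ 𝓗 | ¬ Disjoint (E C) (reach E 𝓗 k A)} E r
      fun C _ ↦ (hr C).le
    calc #(reach E 𝓗 (k + 1) A)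
        ≤ #(reach E 𝓗 k A) + #(reach E 𝓗 k A) * D * r :=
          (card_union_le _ _).trans (Nat.add_le_add_left (h2.trans (Nat.mul_le_mul_right _ h1)) _)
      _ = #(reach E 𝓗 k A) * (1 + r * D) := by ring
      _ ≤ #A * (1 + r * D) ^ k * (1 + r * D) := Nat.mul_le_mul_right _ ih
      _ = _ := by ring

/-- The component of `x` in `𝓢`: a subfamily `𝓣` whose edges all lie near `x`, such that no other
edge of `𝓢` meets `{x} ∪ ⋃ 𝓣`. -/
lemma exists_component (E : ι → Finset X) {𝓢 𝓗 : Finset ι} (h𝓢 : 𝓢 ⊆ 𝓗) (x : X) :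
    ∃ 𝓣 ⊆ 𝓢, insert x (𝓣.biUnion E) ⊆ reach E 𝓗 #𝓢 {x} ∧
      ∀ C ∈ 𝓢, ¬ Disjoint (E C) (insert x (𝓣.biUnion E)) → C ∈ 𝓣 := by
  classical
  obtain ⟨𝓣, h𝓣, hmax⟩ := exists_max_image
    {𝓣 ∈ 𝓢.powerset | insert x (𝓣.biUnion E) ⊆ reach E 𝓗 #𝓣 {x}} card
    ⟨∅, by simp [reach]⟩
  rw [mem_filter, mem_powerset] at h𝓣
  refine ⟨𝓣, h𝓣.1, h𝓣.2.trans (reach_mono E 𝓗 _ (card_le_card h𝓣.1)), fun C hC hd ↦ ?_⟩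
  by_contra hCT
  have := hmax (insert C 𝓣) (by
    rw [mem_filter, mem_powerset, card_insert_of_notMem hCT]
    refine ⟨insert_subset hC h𝓣.1, ?_⟩
    obtain ⟨y, hy, hy'⟩ := not_disjoint_iff.1 hd
    intro z hz
    rw [biUnion_insert, mem_insert, mem_union] at hz
    have key : z ∈ insert x (𝓣.biUnion E) ∨ z ∈ E C := by
      rw [mem_insert]; tauto
    rcases key with hz | hz
    · exact reach_mono E 𝓗 _ (Nat.le_succ _) (h𝓣.2 hz)
    · exact mem_reach_succ (h𝓢 hC) hy hz (h𝓣.2 hy'))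
  rw [card_insert_of_notMem hCT] at this
  omega

/-- If the vertices of `A` are pairwise far apart, hence in distinct components
of a sparse family `𝓢`, then adding the
hyperedge `A` to `𝓢` keeps the family sparse. -/
lemma le_card_span_union {E : ι → Finset X} {𝓢 𝓗 : Finset ι} (h𝓢 : 𝓢 ⊆ 𝓗) {r g : ℕ}
    (hr : ∀ C, (E C).Nonempty) (hsp : SparseUpTo E r g 𝓗) (hg : #𝓢 ≤ g) (A : Finset X)
    (hA : ∀ x ∈ A, ∀ y ∈ A, x ≠ y → y ∉ reach E 𝓗 (2 * #𝓢) {x}) :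
    (r - 1) * #𝓢 + #A ≤ #(𝓢.biUnion E ∪ A) := by
  classical
  choose 𝓣 h𝓣 hreach hcl using exists_component E h𝓢
  have hdisj : (A : Set X).PairwiseDisjoint fun x ↦ insert x ((𝓣 x).biUnion E) := by
    intro x hx y hy hxy
    rw [Function.onFun, disjoint_left]
    intro z hz hz'
    refine hA x hx y hy hxy ?_
    rw [two_mul]
    exact mem_reach_of_mem_reach (hreach y hz') (hreach x hz)
  have hdisjT : (A : Set X).PairwiseDisjoint 𝓣 := by
    intro x hx y hy hxy
    rw [Function.onFun, disjoint_left]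
    intro C hC hC'
    obtain ⟨z, hz⟩ := hr C
    exact disjoint_left.1 (hdisj hx hy hxy)
      (mem_insert_of_mem (mem_biUnion.2 ⟨C, hC, hz⟩))
      (mem_insert_of_mem (mem_biUnion.2 ⟨C, hC', hz⟩))
  set 𝓡 := 𝓢 \ A.biUnion 𝓣 with h𝓡
  have hcard𝓢 : #𝓢 = #𝓡 + ∑ x ∈ A, #(𝓣 x) := by
    rw [← card_biUnion hdisjT, h𝓡, card_sdiff_add_card_eq_card]
    exact biUnion_subset.2 fun x _ ↦ h𝓣 x
  have hsub {𝓤 : Finset ι} (h : 𝓤 ⊆ 𝓢) : (r - 1) * #𝓤 ≤ #(𝓤.biUnion E) := by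
    rcases 𝓤.eq_empty_or_nonempty with rfl | hne
    · simp
    · exact (Nat.le_succ _).trans (hsp _ (h.trans h𝓢) hne ((card_le_card h).trans hg))
  have hcomp (x : X) : (r - 1) * #(𝓣 x) + 1 ≤ #(insert x ((𝓣 x).biUnion E)) := by
    rcases (𝓣 x).eq_empty_or_nonempty with h | hne
    · simp [h]
    · exact (hsp _ ((h𝓣 x).trans h𝓢) hne ((card_le_card (h𝓣 x)).trans hg)).trans
        (card_le_card (subset_insert _ _))
  have hdisjR : Disjoint (𝓡.biUnion E) (A.biUnion fun x ↦ insert x ((𝓣 x).biUnion E)) := by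
    rw [disjoint_left]
    intro z hz hz'
    obtain ⟨C, hC, hzC⟩ := mem_biUnion.1 hz
    obtain ⟨x, hx, hzx⟩ := mem_biUnion.1 hz'
    rw [h𝓡, mem_sdiff] at hC
    exact hC.2 (mem_biUnion.2 ⟨x, hx, hcl x C hC.1 (not_disjoint_iff.2 ⟨z, hzC, hzx⟩)⟩)
  calc (r - 1) * #𝓢 + #A = (r - 1) * #𝓡 + ∑ x ∈ A, ((r - 1) * #(𝓣 x) + 1) := by
        rw [hcard𝓢, sum_add_distrib, ← mul_sum, sum_const, smul_eq_mul]; ring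
    _ ≤ #(𝓡.biUnion E) + ∑ x ∈ A, #(insert x ((𝓣 x).biUnion E)) :=
        Nat.add_le_add (hsub sdiff_subset) (sum_le_sum fun x _ ↦ hcomp x)
    _ = #(𝓡.biUnion E ∪ A.biUnion fun x ↦ insert x ((𝓣 x).biUnion E)) := by
        rw [card_union_of_disjoint hdisjR, card_biUnion hdisj]
    _ ≤ _ := by
        refine card_le_card (union_subset ?_ (biUnion_subset.2 fun x hx ↦ insert_subset ?_ ?_))
        · exact (biUnion_subset_biUnion_of_subset_left _ sdiff_subset).trans subset_union_left
        · exact mem_union_right _ hx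
        · exact (biUnion_subset_biUnion_of_subset_left _ (h𝓣 x)).trans subset_union_left

/-- In a sparse family some hyperedge is a leaf: it shares at most one vertex with the others.
Otherwise the double count of incidences at vertices of degree at least two contradicts
sparsity. -/
lemma exists_leaf [DecidableEq ι] {E : ι → Finset X} {𝓢 : Finset ι} {r : ℕ} (hr : ∀ C, #(E C) = r)
    (hr1 : 1 ≤ r) (hsp : (r - 1) * #𝓢 + 1 ≤ #(𝓢.biUnion E)) :
    ∃ C ∈ 𝓢, #(E C ∩ (𝓢.erase C).biUnion E) ≤ 1 := by
  by_contra! hcon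
  set d : X → ℕ := fun x ↦ #{C ∈ 𝓢 | x ∈ E C} with hd
  set Y := 𝓢.biUnion E with hY
  have hd1 : ∀ x ∈ Y, 1 ≤ d x := by
    intro x hx
    obtain ⟨C, hC, hxC⟩ := mem_biUnion.1 hx
    exact card_pos.2 ⟨C, mem_filter.2 ⟨hC, hxC⟩⟩
  have hswap (Z : Finset X) : ∑ x ∈ Z, d x = ∑ C ∈ 𝓢, #{x ∈ Z | x ∈ E C} :=
    sum_card_bipartiteAbove_eq_sum_card_bipartiteBelow fun x C ↦ x ∈ E C
  have hsum : ∑ x ∈ Y, d x = r * #𝓢 := by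
    rw [hswap]
    calc _ = ∑ C ∈ 𝓢, r := by
          refine sum_congr rfl fun C hC ↦ ?_
          rw [← hr C]
          congr 1
          ext x
          simp only [mem_filter, and_iff_right_iff_imp]
          exact fun hx ↦ mem_biUnion.2 ⟨C, hC, hx⟩
      _ = _ := by simp [mul_comm]
  have hsum2 : 2 * #𝓢 ≤ ∑ x ∈ Y with 2 ≤ d x, d x := by
    rw [hswap]
    calc 2 * #𝓢 = ∑ C ∈ 𝓢, 2 := by simp [mul_comm]
      _ ≤ _ := by
        refine sum_le_sum fun C hC ↦ ?_
        refine (Nat.succ_le_of_lt (hcon C hC)).trans (card_le_card fun x hx ↦ ?_)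
        rw [mem_inter, mem_biUnion] at hx
        obtain ⟨hxC, C', hC', hxC'⟩ := hx
        rw [mem_erase] at hC'
        refine mem_filter.2 ⟨mem_filter.2 ⟨mem_biUnion.2 ⟨C, hC, hxC⟩, ?_⟩, hxC⟩
        exact one_lt_card.2 ⟨C, mem_filter.2 ⟨hC, hxC⟩, C', mem_filter.2 ⟨hC'.2, hxC'⟩,
          fun h ↦ hC'.1 h.symm⟩
  have h3 : ∑ x ∈ Y with 2 ≤ d x, d x + 2 * #Y ≤ 2 * ∑ x ∈ Y, d x := by
    rw [sum_filter, card_eq_sum_ones, mul_sum, mul_sum, ← sum_add_distrib]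
    refine sum_le_sum fun x hx ↦ ?_
    have := hd1 x hx
    split_ifs <;> omega
  obtain ⟨s, rfl⟩ : ∃ s, r = s + 1 := ⟨r - 1, by omega⟩
  rw [hsum] at h3
  simp only [Nat.add_sub_cancel] at hsp
  nlinarith

end Hypergraph

/-! ### Existence of dense sparse hypergraphs -/

section Greedy

open Finset

/-- The hyperedge of an `r`-partite hypergraph on `Fin r × Fin n` that has the vertex `(a, e a)`
in part `a`. -/
def graphEdge {r n : ℕ} (e : Fin r → Fin n) : Finset (Fin r × Fin n) :=
  univ.map ⟨fun a ↦ (a, e a), fun _ _ h ↦ congrArg Prod.fst h⟩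

lemma mem_graphEdge {r n : ℕ} {e : Fin r → Fin n} {x : Fin r × Fin n} :
    x ∈ graphEdge e ↔ e x.1 = x.2 := by
  simp only [graphEdge, mem_map, mem_univ, true_and]
  constructor
  · rintro ⟨a, rfl⟩; rfl
  · intro h; exact ⟨x.1, Prod.ext rfl h⟩

@[simp] lemma card_graphEdge {r n : ℕ} (e : Fin r → Fin n) : #(graphEdge e) = r := by
  simp [graphEdge]

/-- Greedy choice of a new hyperedge: one vertex from each large set `S a`, pairwise far apart. -/
lemma exists_far_transversal {r n D g : ℕ} {𝓗 : Finset (Fin r → Fin n)}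
    (hD : ∀ x, #{C ∈ 𝓗 | x ∈ graphEdge C} ≤ D) (S : Fin r → Finset (Fin n))
    (hS : ∀ a, r * (1 + r * D) ^ g < #(S a)) :
    ∃ e : Fin r → Fin n, (∀ a, e a ∈ S a) ∧
      ∀ a b, a ≠ b → (b, e b) ∉ reach graphEdge 𝓗 g {(a, e a)} := by
  suffices h : ∀ s : Finset (Fin r), ∃ e : Fin r → Fin n, (∀ a, e a ∈ S a) ∧
      ∀ a ∈ s, ∀ b ∈ s, a ≠ b → (b, e b) ∉ reach graphEdge 𝓗 g {(a, e a)} by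
    simpa using h univ
  intro s
  induction s using Finset.induction_on with
  | empty =>
    have : ∀ a, (S a).Nonempty := fun a ↦ card_pos.1 ((Nat.zero_le _).trans_lt (hS a))
    choose e he using this
    exact ⟨e, he, by simp⟩
  | insert b s hb ih =>
    obtain ⟨e, he, hfar⟩ := ih
    have hcard : #(s.biUnion fun a ↦ (reach graphEdge 𝓗 g {(a, e a)}).image Prod.snd)
        < #(S b) := by
      refine lt_of_le_of_lt ?_ (hS b)
      refine (card_biUnion_le_card_mul _ _ ((1 + r * D) ^ g) fun a _ ↦ ?_).trans
        (Nat.mul_le_mul_right _ (by simpa using card_le_univ s))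
      refine card_image_le.trans ((card_reach_le card_graphEdge hD _ _).trans ?_)
      simp
    obtain ⟨i, hi, hi'⟩ := exists_mem_notMem_of_card_lt_card hcard
    have hfar' : ∀ a ∈ s, (b, i) ∉ reach graphEdge 𝓗 g {(a, e a)} := fun a ha h ↦
      hi' (mem_biUnion.2 ⟨a, ha, mem_image.2 ⟨_, h, rfl⟩⟩)
    have hne : ∀ a ∈ s, a ≠ b := fun a ha h ↦ hb (h ▸ ha)
    refine ⟨Function.update e b i, fun a ↦ ?_, fun a ha c hc hac ↦ ?_⟩
    · by_cases h : a = b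
      · subst h; simpa using hi
      · simpa [h] using he a
    · rw [mem_insert] at ha hc
      rcases ha with rfl | ha <;> rcases hc with rfl | hc
      · exact absurd rfl hac
      · rw [Function.update_self, Function.update_of_ne (hne c hc)]
        intro h
        have := mem_reach_of_mem_reach (k := 0) h (mem_singleton_self _)
        rw [Nat.zero_add] at this
        exact hfar' c hc this
      · rw [Function.update_self, Function.update_of_ne (hne a ha)]
        exact hfar' a ha
      · rw [Function.update_of_ne (hne a ha), Function.update_of_ne (hne c hc)]
        exact hfar a ha c hc hac

/-- A family that is maximal among the `g`-sparse `r`-partite ones with maximum degree at most `D`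
has almost `D n` hyperedges: otherwise every part has many vertices of degree less than `D`, and
a hyperedge on such vertices that are far apart can be added. -/
theorem exists_sparse_family {r n D g : ℕ} (hr : 2 ≤ r) (hg : 1 ≤ g) :
    ∃ 𝓗 : Finset (Fin r → Fin n), SparseUpTo graphEdge r g 𝓗 ∧
      D * n ≤ #𝓗 + D * (r * (1 + r * D) ^ (2 * g)) := by
  classical
  obtain ⟨𝓗, h𝓗, hmax⟩ := exists_max_image
    ({𝓗 | SparseUpTo graphEdge r g 𝓗 ∧ ∀ x, #{C ∈ 𝓗 | x ∈ graphEdge C} ≤ D} :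
      Finset (Finset (Fin r → Fin n))) card
    ⟨∅, by
      refine mem_filter.2 ⟨mem_univ _, fun 𝓢 h𝓢 hne ↦ ?_, by simp⟩
      rw [subset_empty.1 h𝓢] at hne
      simp at hne⟩
  simp only [mem_filter, mem_univ, true_and] at h𝓗 hmax
  obtain ⟨hsp, hD⟩ := h𝓗
  refine ⟨𝓗, hsp, ?_⟩
  by_contra! hcon
  set S : Fin r → Finset (Fin n) := fun a ↦ {i | #{C ∈ 𝓗 | (a, i) ∈ graphEdge C} < D} with hS
  have hScard : ∀ a, r * (1 + r * D) ^ (2 * g) < #(S a) := by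
    intro a
    by_contra! hle
    have h1 : #𝓗 = ∑ i, #{C ∈ 𝓗 | (a, i) ∈ graphEdge C} := by
      simp only [mem_graphEdge]
      exact card_eq_sum_card_fiberwise fun C _ ↦ mem_univ (C a)
    have h2 : D * n ≤ #𝓗 + D * #(S a) := by
      calc D * n = ∑ i : Fin n, D := by simp [mul_comm]
        _ ≤ ∑ i, (#{C ∈ 𝓗 | (a, i) ∈ graphEdge C} + if i ∈ S a then D else 0) := by
          refine sum_le_sum fun i _ ↦ ?_
          by_cases hi : i ∈ S a
          · simp [hi]
          · rw [if_neg hi]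
            simpa [hS] using hi
        _ = _ := by
          rw [sum_add_distrib, ← h1, ← sum_filter]
          simp [mul_comm]
    exact absurd (h2.trans (Nat.add_le_add_left (Nat.mul_le_mul_left D hle) _)) (not_le.2 hcon)
  obtain ⟨e, heS, hfar⟩ := exists_far_transversal hD S hScard
  have heE {a : Fin r} : (a, e a) ∈ graphEdge e := mem_graphEdge.2 rfl
  have he : e ∉ 𝓗 := by
    intro he
    have h01 : (⟨0, by omega⟩ : Fin r) ≠ ⟨1, by omega⟩ := by simp
    refine hfar _ _ h01 (reach_mono graphEdge 𝓗 _ (show 0 + 1 ≤ 2 * g by omega) ?_)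
    exact mem_reach_succ he heE heE (mem_singleton_self _)
  have hins : SparseUpTo graphEdge r g (insert e 𝓗) ∧
      ∀ x, #{C ∈ insert e 𝓗 | x ∈ graphEdge C} ≤ D := by
    constructor
    · intro 𝓢 h𝓢 hne hg'
      by_cases heS' : e ∈ 𝓢
      · have hsub : 𝓢.erase e ⊆ 𝓗 := by
          rwa [← subset_insert_iff]
        have hc := card_erase_add_one heS'
        have := le_card_span_union (r := r) hsub
          (fun C ↦ card_pos.1 (by rw [card_graphEdge]; omega)) hsp (by omega) (graphEdge e) (by
            intro x hx y hy hxy hmem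
            rw [mem_graphEdge] at hx hy
            obtain ⟨a, i⟩ := x
            obtain ⟨b, i'⟩ := y
            simp only at hx hy
            subst hx hy
            refine hfar a b (fun h ↦ hxy (by rw [h])) ?_
            exact reach_mono graphEdge 𝓗 _ (by omega) hmem)
        rw [card_graphEdge] at this
        have hU : 𝓢.biUnion graphEdge = (𝓢.erase e).biUnion graphEdge ∪ graphEdge e := by
          conv_lhs => rw [← insert_erase heS', biUnion_insert, union_comm]
        rw [hU, ← hc, Nat.mul_add]
        omega
      · exact hsp 𝓢 ((subset_insert_iff_of_notMem heS').1 h𝓢) hne hg'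
    · intro x
      rw [filter_insert]
      split_ifs with hx
      · refine (card_insert_le _ _).trans ?_
        obtain ⟨a, i⟩ := x
        rw [mem_graphEdge] at hx
        simp only at hx
        subst hx
        have := heS a
        simp only [hS, mem_filter, mem_univ, true_and] at this
        exact this
      · exact hD x
  have := hmax _ hins
  rw [card_insert_of_notMem he] at this
  omega

end Greedy

/-! ### Star graphs of families of copies -/

section Hypergraph

open Finset

/-- Two hyperedges of a sparse uniform family share at most one vertex. -/
lemma SparseUpTo.card_inter_le_one {ι X : Type*} [DecidableEq X] {E : ι → Finset X}
    {r g : ℕ} {𝓗 : Finset ι} (h : SparseUpTo E r g 𝓗) (hr : ∀ C, #(E C) = r) (hg : 2 ≤ g)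
    {C C' : ι} (hC : C ∈ 𝓗) (hC' : C' ∈ 𝓗) (hne : C ≠ C') : #(E C ∩ E C') ≤ 1 := by
  classical
  have h1 := h {C, C'} (by simp [insert_subset_iff, hC, hC']) (by simp)
    (by rwa [card_pair hne])
  rw [card_pair hne, biUnion_insert, singleton_biUnion] at h1
  have h2 := card_union_add_card_inter (E C) (E C')
  rw [hr, hr] at h2
  omega

end Hypergraph

section Star

open Set

/-- If every nonempty subfamily of a family of copies of `F` has a leaf, then their union is an
`F`-forest. -/
lemma fForestOn_of_leaves {V ι U : Type*} [DecidableEq ι] (F : SimpleGraph V) (j : ι → V ↪ U)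
    (𝓢 : Finset ι)
    (h : ∀ 𝓣 ⊆ 𝓢, 𝓣.Nonempty →
      ∃ C ∈ 𝓣, ((⋃ C' ∈ 𝓣.erase C, range (j C')) ∩ range (j C)).Subsingleton) :
    FForestOn F (⋃ C ∈ 𝓢, range (j C)) (⨆ C ∈ 𝓢, F.map (j C)) := by
  induction 𝓢 using Finset.strongInduction with
  | H 𝓢 ih =>
    rcases 𝓢.eq_empty_or_nonempty with rfl | hne
    · simpa using FForestOn.empty (F := F) (U := U)
    · obtain ⟨C, hC, hsub⟩ := h 𝓢 subset_rfl hne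
      have := FForestOn.add _ _ (j C) (ih _ (Finset.erase_ssubset hC)
        fun 𝓣 h𝓣 ↦ h 𝓣 (h𝓣.trans (Finset.erase_subset _ _))) hsub
      rw [← Finset.insert_erase hC, Finset.set_biUnion_insert, Finset.iSup_insert, union_comm,
        sup_comm]
      exact this

variable {V : Type*} [Fintype V] (F : SimpleGraph V) [DecidableRel F.Adj]

/-- The star construction for a family `j` of (not necessarily all) labelled copies of `F` in a
vertex set `X`: `starGraph` with coordinates indexed by the given copies only, and with labels
transferred through the embeddings `j C`. -/
def familyStar {ι X : Type*} (o : EdgeOrdering F) (j : ι → V ↪ X) :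
    SimpleGraph (X × (ι → Fin F.maxDegree)) where
  Adj p q := ∃ (C : ι) (a b : V) (h : F.Adj a b), j C a = p.1 ∧ j C b = q.1 ∧
      (p.2 C : ℕ) = (o a ⟨b, h⟩ : ℕ) ∧ (q.2 C : ℕ) = (o b ⟨a, h.symm⟩ : ℕ)
  symm := by
    refine ⟨?_⟩
    rintro p q ⟨C, a, b, h, h1, h2, h3, h4⟩
    exact ⟨C, b, a, h.symm, h2, h1, h4, h3⟩
  loopless := by
    refine ⟨?_⟩
    rintro p ⟨C, a, b, h, h1, h2, -, -⟩
    exact h.ne ((j C).injective (h1.trans h2.symm))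

/-- The star of the family of all `j C` maps to the star graph of the union `T` of the copies,
however the isomorphisms `iso` are chosen: two isomorphisms from `F` to a copy differ by an
automorphism of `F`, which permutes the labels at each vertex of the copy, and the coordinate
of this copy is changed accordingly. -/
lemma nonempty_familyStar_hom {κ U : Type*} (o : EdgeOrdering F) (hΔ : 0 < F.maxDegree)
    (j : κ → V ↪ U) (hj : Function.Injective fun C ↦ range (j C)) (T : SimpleGraph U)
    (hT : ∀ C, F.map (j C) ≤ T) (iso : ∀ C : FCopy F T, F ≃g C.1.coe) :
    Nonempty (familyStar F o j →g starGraph F o T iso) := by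
  classical
  let c (C : κ) : SimpleGraph.Copy F T :=
    ⟨⟨j C, fun {a b} h ↦ hT C (SimpleGraph.map_adj_apply.2 h)⟩, (j C).injective⟩
  let K (C : κ) : FCopy F T := ⟨(c C).toSubgraph, ⟨(c C).isoToSubgraph⟩⟩
  have hK : Function.Injective K := by
    intro C C' h
    refine hj ?_
    have : (c C).toSubgraph.verts = (c C').toSubgraph.verts :=
      congrArg (fun L : FCopy F T ↦ L.1.verts) h
    simpa [c, SimpleGraph.Copy.toSubgraph] using this
  let α (C : κ) : F ≃g F := ((c C).isoToSubgraph).trans (iso (K C)).symm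
  have hα (C : κ) (a : V) : (iso (K C) (α C a) : U) = j C a := by
    have : iso (K C) (α C a) = (c C).isoToSubgraph a := (iso (K C)).apply_symm_apply _
    rw [this]
    rfl
  have hlabel (C : κ) (u : U) (x : Fin F.maxDegree) : ∃ y : Fin F.maxDegree,
      ∀ a b (h : F.Adj a b), j C a = u → (x : ℕ) = (o a ⟨b, h⟩ : ℕ) →
        (y : ℕ) = (o (α C a) ⟨α C b, (α C).map_adj_iff.2 h⟩ : ℕ) := by
    by_cases hex : ∃ a b, ∃ h : F.Adj a b, j C a = u ∧ (x : ℕ) = (o a ⟨b, h⟩ : ℕ)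
    · obtain ⟨a, b, h, hu, hx⟩ := hex
      refine ⟨⟨o (α C a) ⟨α C b, (α C).map_adj_iff.2 h⟩,
        (Fin.is_lt _).trans_le (F.degree_le_maxDegree _)⟩, fun a' b' h' hu' hx' ↦ ?_⟩
      obtain rfl := (j C).injective (hu.trans hu'.symm)
      have := (o a).injective (Fin.ext (hx.symm.trans hx'))
      obtain rfl : b = b' := congrArg Subtype.val this
      rfl
    · exact ⟨x, fun a b h hu hx ↦ (hex ⟨a, b, h, hu, hx⟩).elim⟩
  choose y hy using hlabel
  refine ⟨⟨fun p ↦ (p.1, Function.extend K (fun C ↦ y C p.1 (p.2 C)) fun _ ↦ ⟨0, hΔ⟩), ?_⟩⟩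
  rintro p q ⟨C, a, b, h, h1, h2, h3, h4⟩
  refine ⟨K C, α C a, α C b, (α C).map_adj_iff.2 h, (hα C a).trans h1, (hα C b).trans h2, ?_, ?_⟩
  · exact (congrArg Fin.val (hK.extend_apply _ _ C)).trans (hy C p.1 (p.2 C) a b h h1 h3)
  · exact (congrArg Fin.val (hK.extend_apply _ _ C)).trans (hy C q.1 (q.2 C) b a h.symm h2 h4)

/-- A homomorphism from a small graph `H` to the star of a sparse `F`-partite family of copies of
`F` only uses few of the copies, and these form an `F`-forest that maps to `F`. -/
theorem exists_forest_of_hom_familyStar {W : Type*} [Finite W] {ι X : Type} [Fintype ι]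
    [DecidableEq X] (H : SimpleGraph W) (o : EdgeOrdering F) (hΔ : 0 < F.maxDegree)
    (iso : ∀ (U : Type) (T : SimpleGraph U) (C : FCopy F T), F ≃g C.1.coe)
    (hV : 2 ≤ Fintype.card V) (j : ι → V ↪ X) (p : X → V) (hp : ∀ C a, p (j C a) = a)
    [Nonempty ι] {g : ℕ} (hg : Nat.card W ^ 2 ≤ g) (hg2 : 2 ≤ g)
    (hsp : SparseUpTo (fun C ↦ Finset.univ.map (j C)) (Fintype.card V) g Finset.univ)
    (φ : H →g familyStar F o j) :
    ∃ (U : Type) (T : SimpleGraph U), IsFForest F T ∧ Nonempty (T →g F) ∧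
      Nonempty (H →g starGraph F o T (iso U T)) := by
  classical
  have := Fintype.ofFinite W
  obtain ⟨v₀⟩ : Nonempty V := Fintype.card_pos_iff.1 (by omega)
  have hex (e : W × W) : ∃ C, H.Adj e.1 e.2 → ∃ (a b : V) (h : F.Adj a b),
      j C a = (φ e.1).1 ∧ j C b = (φ e.2).1 ∧
      ((φ e.1).2 C : ℕ) = (o a ⟨b, h⟩ : ℕ) ∧ ((φ e.2).2 C : ℕ) = (o b ⟨a, h.symm⟩ : ℕ) := by
    by_cases h : H.Adj e.1 e.2
    · obtain ⟨C, hC⟩ := φ.map_adj h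
      exact ⟨C, fun _ ↦ hC⟩
    · exact ⟨Classical.arbitrary ι, fun h' ↦ (h h').elim⟩
  choose c hc using hex
  set 𝓢 : Finset ι := Finset.univ.image c with h𝓢
  have hc𝓢 (e : W × W) : c e ∈ 𝓢 := Finset.mem_image_of_mem c (Finset.mem_univ e)
  have h𝓢g : 𝓢.card ≤ g := by
    refine Finset.card_image_le.trans (le_trans ?_ hg)
    simp [sq, Fintype.card_prod]
  let U : Type := {x : X // ∃ C ∈ 𝓢, ∃ a, j C a = x}
  let j' (C : {C // C ∈ 𝓢}) : V ↪ U :=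
    ⟨fun a ↦ ⟨j C a, C, C.2, a, rfl⟩, fun a b h ↦ (j C).injective (congrArg Subtype.val h)⟩
  let E (C : {C // C ∈ 𝓢}) : Finset X := Finset.univ.map (j C)
  have hE (C) : (E C).card = Fintype.card V := by simp [E]
  have hrange (C) (x : U) : x ∈ range (j' C) ↔ x.1 ∈ E C := by
    simp only [E, Finset.mem_map, Finset.mem_univ, true_and]
    exact ⟨fun ⟨a, h⟩ ↦ ⟨a, congrArg Subtype.val h⟩, fun ⟨a, h⟩ ↦ ⟨a, Subtype.ext h⟩⟩
  have hinj : Function.Injective fun C ↦ range (j' C) := by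
    intro C C' h
    by_contra hne
    replace h : range (j' C) = range (j' C') := h
    have h1 := hsp.card_inter_le_one (by simp) hg2 (Finset.mem_univ C.1) (Finset.mem_univ C'.1)
      fun h ↦ hne (Subtype.ext h)
    have h2 : E C = E C' := by
      ext x
      constructor <;> intro hx
      · obtain ⟨a, -, rfl⟩ := Finset.mem_map.1 hx
        exact (hrange C' (j' C a)).1 (h ▸ mem_range_self a)
      · obtain ⟨a, -, rfl⟩ := Finset.mem_map.1 hx
        exact (hrange C (j' C' a)).1 (h ▸ mem_range_self a)
    have h3 : (E C ∩ E C').card ≤ 1 := h1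
    rw [← h2, Finset.inter_self, hE] at h3
    omega
  have hforest := fForestOn_of_leaves F j' Finset.univ (by
    intro 𝓣 _ hne
    have h1 := hsp (𝓣.image Subtype.val) (Finset.subset_univ _)
      (hne.image _) (by
        refine (Finset.card_le_card ?_).trans h𝓢g
        intro C hC
        obtain ⟨C', -, rfl⟩ := Finset.mem_image.1 hC
        exact C'.2)
    rw [Finset.card_image_of_injective _ Subtype.val_injective, Finset.image_biUnion] at h1
    obtain ⟨C, hC, hle⟩ := exists_leaf hE (by omega) h1
    refine ⟨C, hC, fun x hx y hy ↦ Subtype.ext (Finset.card_le_one.1 hle _ ?_ _ ?_)⟩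
    all_goals
      rw [Finset.mem_inter, Finset.mem_biUnion]
      simp only [mem_inter_iff, mem_iUnion, exists_prop, hrange] at hx hy
      tauto)
  set T : SimpleGraph U := ⨆ C ∈ (Finset.univ : Finset {C // C ∈ 𝓢}), F.map (j' C) with hT
  have hTle (C) : F.map (j' C) ≤ T := le_iSup₂_of_le C (Finset.mem_univ C) le_rfl
  refine ⟨U, T, ?_, ⟨⟨fun x ↦ p x.1, ?_⟩⟩, ?_⟩
  · have huniv : ⋃ C ∈ (Finset.univ : Finset {C // C ∈ 𝓢}), range (j' C) = Set.univ := by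
      refine eq_univ_of_forall fun x ↦ ?_
      obtain ⟨C, hC, a, ha⟩ := x.2
      exact mem_iUnion₂.2 ⟨⟨C, hC⟩, Finset.mem_univ _, a, Subtype.ext ha⟩
    rw [huniv] at hforest
    exact hforest
  · intro x y hxy
    simp only [hT, SimpleGraph.iSup_adj] at hxy
    obtain ⟨C, -, h⟩ := hxy
    obtain ⟨a, b, hab, rfl, rfl⟩ := (SimpleGraph.map_adj _ _ _ _).1 h
    change F.Adj (p (j C a)) (p (j C b))
    rwa [hp, hp]
  · obtain ⟨ψ⟩ := nonempty_familyStar_hom F o hΔ j' hinj T hTle (iso U T)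
    -- Vertices of `H` without neighbours may be mapped outside `U`, and are moved into `U`.
    refine ⟨ψ.comp ⟨fun w ↦ (if h : ∃ C ∈ 𝓢, ∃ a, j C a = (φ w).1 then ⟨(φ w).1, h⟩
      else j' ⟨c (w, w), hc𝓢 _⟩ v₀, fun C ↦ (φ w).2 C), ?_⟩⟩
    intro w w' hww
    obtain ⟨a, b, h, h1, h2, h3, h4⟩ := hc (w, w') hww
    refine ⟨⟨c (w, w'), hc𝓢 _⟩, a, b, h, ?_, ?_, h3, h4⟩
    · simp only
      rw [dif_pos ⟨c (w, w'), hc𝓢 _, a, h1⟩]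
      exact Subtype.ext h1
    · simp only
      rw [dif_pos ⟨c (w, w'), hc𝓢 _, b, h2⟩]
      exact Subtype.ext h2

end Star

/-! ### Balanced coordinates of subsets of a cube -/

section Cube

open Finset

variable {ι : Type*} [Fintype ι] [DecidableEq ι] {Δ : ℕ}

/-- A set `P ⊆ {1, …, Δ}^ι` is balanced at the coordinate `C` if each of the `Δ` values of this
coordinate is attained on at least a `1 / (2 Δ)` fraction of `P`. -/
def Balanced (P : Finset (ι → Fin Δ)) (C : ι) : Prop :=
  ∀ i : Fin Δ, #P ≤ 2 * Δ * #{x ∈ P | x C = i}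

/-- A set with many coordinates at which some value is too rare is exponentially small: compare
the averages over the set and over the cube of `exp (-Z)`, where `Z x` is the number of
coordinates in `B` at which `x` has the rare value. -/
lemma card_mul_exp_le (hΔ : 0 < Δ) (P : Finset (ι → Fin Δ)) (B : Finset ι) (i : ι → Fin Δ)
    (h : ∀ C ∈ B, 2 * Δ * #{x ∈ P | x C = i C} ≤ #P) :
    (#P : ℝ) * Real.exp (#B / (8 * Δ)) ≤ (Δ : ℝ) ^ Fintype.card ι := by
  have hΔ' : (0 : ℝ) < Δ := by exact_mod_cast hΔ
  set z : ι → Fin Δ → ℝ := fun C v ↦ if C ∈ B ∧ v = i C then 1 else 0 with hz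
  set μ : ℝ := #B / (2 * Δ) with hμ
  have hZ : ∑ x ∈ P, ∑ C, z C (x C) ≤ #P * μ := by
    rw [sum_comm]
    have h1 (C : ι) : ∑ x ∈ P, z C (x C) ≤ if C ∈ B then (#P : ℝ) / (2 * Δ) else 0 := by
      by_cases hC : C ∈ B
      · have h2 : ((2 * Δ * #{x ∈ P | x C = i C} : ℕ) : ℝ) ≤ #P := by exact_mod_cast h C hC
        simp only [hz, hC, true_and, if_true, sum_boole]
        rw [le_div_iff₀ (by positivity)]
        push_cast at h2
        linarith
      · simp [hz, hC]
    refine (sum_le_sum fun C _ ↦ h1 C).trans (le_of_eq ?_)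
    rw [← sum_filter, sum_const, nsmul_eq_mul, hμ]
    simp only [filter_univ_mem]
    ring
  have hlow : (#P : ℝ) * Real.exp (-μ) ≤ ∑ x ∈ P, Real.exp (-∑ C, z C (x C)) := by
    calc (#P : ℝ) * Real.exp (-μ)
        ≤ ∑ x ∈ P, Real.exp (-μ) * (μ - ∑ C, z C (x C) + 1) := by
          rw [← mul_sum, sum_add_distrib, sum_sub_distrib]
          simp only [sum_const, nsmul_eq_mul, mul_one]
          nlinarith [Real.exp_pos (-μ)]
      _ ≤ _ := by
          refine sum_le_sum fun x _ ↦ ?_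
          calc _ ≤ Real.exp (-μ) * Real.exp (μ - ∑ C, z C (x C)) :=
                mul_le_mul_of_nonneg_left (Real.add_one_le_exp _) (Real.exp_pos _).le
            _ = _ := by rw [← Real.exp_add]; congr 1; ring
  have hfactor (C : ι) : ∑ v, Real.exp (-z C v) ≤
      Δ * Real.exp (-(if C ∈ B then 5 / (8 * (Δ : ℝ)) else 0)) := by
    by_cases hC : C ∈ B
    · -- The constant is chosen with `1 - exp (-1) > 5 / 8 > 1 / 2`; the excess over `1 / 2`
      -- is the final exponent `1 / 8`.
      have h1 (v : Fin Δ) : Real.exp (-z C v) ≤ 1 - if v = i C then 5 / 8 else 0 := by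
        by_cases hv : v = i C
        · simp only [hz, hC, hv, and_self, if_true]
          rw [Real.exp_neg, inv_le_comm₀ (Real.exp_pos _) (by norm_num)]
          exact le_trans (by norm_num) Real.exp_one_gt_d9.le
        · simp [hz, hv]
      refine (sum_le_sum fun v _ ↦ h1 v).trans ?_
      rw [sum_sub_distrib]
      simp only [sum_const, card_univ, Fintype.card_fin, nsmul_eq_mul, mul_one, sum_ite_eq',
        mem_univ, if_true, hC]
      have h2 := Real.add_one_le_exp (-(5 / (8 * Δ)) : ℝ)
      calc (Δ : ℝ) - 5 / 8 = Δ * (-(5 / (8 * Δ)) + 1) := by field_simp; ring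
        _ ≤ _ := mul_le_mul_of_nonneg_left h2 hΔ'.le
    · simp [hz, hC]
  have hup : ∑ x ∈ P, Real.exp (-∑ C, z C (x C)) ≤
      (Δ : ℝ) ^ Fintype.card ι * Real.exp (-(5 * #B / (8 * Δ))) := by
    calc ∑ x ∈ P, Real.exp (-∑ C, z C (x C))
        ≤ ∑ x : ι → Fin Δ, Real.exp (-∑ C, z C (x C)) :=
          sum_le_sum_of_subset_of_nonneg (subset_univ P) fun x _ _ ↦ (Real.exp_pos _).le
      _ = ∑ x : ι → Fin Δ, ∏ C, Real.exp (-z C (x C)) := by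
          simp only [← sum_neg_distrib, Real.exp_sum]
      _ = ∏ C, ∑ v, Real.exp (-z C v) := by
          rw [prod_univ_sum, Fintype.piFinset_univ]
      _ ≤ ∏ C, Δ * Real.exp (-(if C ∈ B then 5 / (8 * (Δ : ℝ)) else 0)) :=
          prod_le_prod (fun C _ ↦ sum_nonneg fun v _ ↦ (Real.exp_pos _).le) fun C _ ↦ hfactor C
      _ = _ := by
          rw [prod_mul_distrib, prod_const, card_univ, ← Real.exp_sum, sum_neg_distrib,
            ← sum_filter, sum_const, nsmul_eq_mul]
          simp only [filter_univ_mem]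
          congr 3
          ring
  calc (#P : ℝ) * Real.exp (#B / (8 * Δ))
      = #P * Real.exp (-μ) * Real.exp (5 * #B / (8 * Δ)) := by
        rw [mul_assoc, ← Real.exp_add]
        congr 2
        rw [hμ]
        field_simp
        ring
    _ ≤ (Δ : ℝ) ^ Fintype.card ι * Real.exp (-(5 * #B / (8 * Δ))) *
          Real.exp (5 * #B / (8 * Δ)) :=
        mul_le_mul_of_nonneg_right (hlow.trans hup) (Real.exp_pos _).le
    _ = _ := by rw [mul_assoc, ← Real.exp_add, neg_add_cancel, Real.exp_zero, mul_one]

open Classical in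
/-- A set of density at least `1 / L` is balanced at all but `O(log L)` coordinates. -/
lemma card_unbalanced_le (hΔ : 0 < Δ) (P : Finset (ι → Fin Δ)) (hP : P.Nonempty) {L : ℝ}
    (hL : 0 < L) (h : (Δ : ℝ) ^ Fintype.card ι ≤ L * #P) :
    (#{C | ¬ Balanced P C} : ℝ) ≤ 8 * Δ * Real.log L := by
  have hΔ' : (0 : ℝ) < Δ := by exact_mod_cast hΔ
  have hP' : (0 : ℝ) < #P := by exact_mod_cast hP.card_pos
  have hex (C : ι) : ∃ i : Fin Δ, ¬ Balanced P C → 2 * Δ * #{x ∈ P | x C = i} ≤ #P := by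
    by_cases hC : Balanced P C
    · exact ⟨⟨0, hΔ⟩, fun h ↦ (h hC).elim⟩
    · simp only [Balanced, not_forall, not_le] at hC
      obtain ⟨i, hi⟩ := hC
      exact ⟨i, fun _ ↦ hi.le⟩
  choose i hi using hex
  have h1 := (card_mul_exp_le hΔ P {C | ¬ Balanced P C} i fun C hC ↦
    hi C (mem_filter.1 hC).2).trans h
  rw [mul_comm L, mul_le_mul_iff_right₀ hP', ← Real.le_log_iff_exp_le hL,
    div_le_iff₀ (by positivity)] at h1
  linarith

open Classical in
/-- Colour a cube with `k` colours. A random point then lies in a colour class that is balanced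
at all but `O(log k)` coordinates, with exceptions of probability at most `1 / K`. -/
lemma sum_card_unbalanced_le (hΔ : 0 < Δ) {k : ℕ} (c : (ι → Fin Δ) → Fin k) (I : Finset ι)
    {K : ℝ} (hK : 1 ≤ K) :
    ((∑ x, #{C ∈ I | ¬ Balanced {x' | c x' = c x} C} : ℕ) : ℝ) ≤
      (Δ : ℝ) ^ Fintype.card ι * (8 * Δ * Real.log (K * k)) +
        (Δ : ℝ) ^ Fintype.card ι / K * #I := by
  set q : ℝ := (Δ : ℝ) ^ Fintype.card ι with hq
  have hΔ' : (0 : ℝ) < Δ := by exact_mod_cast hΔ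
  have : Nonempty (Fin Δ) := ⟨⟨0, hΔ⟩⟩
  have hk : 1 ≤ k := by
    have := (c (Classical.arbitrary _)).pos
    omega
  have hk' : (1 : ℝ) ≤ k := by exact_mod_cast hk
  have hKk : 1 ≤ K * k := one_le_mul_of_one_le_of_one_le hK hk'
  have hcardq : ((Fintype.card (ι → Fin Δ) : ℕ) : ℝ) = q := by simp [hq]
  set small : Finset (Fin k) := {γ | K * k * #{x | c x = γ} < q} with hsmall
  have hsm : (#{x | c x ∈ small} : ℝ) ≤ q / K := by
    rw [card_eq_sum_card_fiberwise (f := c) (t := small) (by intro x hx; simpa using hx)]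
    push_cast
    calc _ ≤ ∑ γ ∈ small, q / (K * k) := by
          refine sum_le_sum fun γ hγ ↦ ?_
          rw [le_div_iff₀ (by positivity)]
          simp only [hsmall, mem_filter, mem_univ, true_and] at hγ
          refine le_trans ?_ hγ.le
          rw [mul_comm]
          refine mul_le_mul_of_nonneg_left ?_ (by positivity)
          exact_mod_cast card_le_card fun x hx ↦ by
            simp only [mem_filter, mem_univ, true_and] at hx ⊢
            exact hx.2
      _ = #small * (q / (K * k)) := by rw [sum_const, nsmul_eq_mul]
      _ ≤ k * (q / (K * k)) := by
          refine mul_le_mul_of_nonneg_right ?_ (by positivity)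
          exact_mod_cast (card_le_univ small).trans (by simp)
      _ = q / K := by field_simp
  have hterm (x : ι → Fin Δ) : (#{C ∈ I | ¬ Balanced {x' | c x' = c x} C} : ℝ) ≤
      8 * Δ * Real.log (K * k) + if c x ∈ small then (#I : ℝ) else 0 := by
    have hlog : 0 ≤ Real.log (K * k) := Real.log_nonneg hKk
    by_cases hx : c x ∈ small
    · rw [if_pos hx]
      have : (#{C ∈ I | ¬ Balanced {x' | c x' = c x} C} : ℝ) ≤ #I := by
        exact_mod_cast card_filter_le _ _
      have : 0 ≤ 8 * Δ * Real.log (K * k) := by positivity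
      linarith
    · rw [if_neg hx, add_zero]
      simp only [hsmall, mem_filter, mem_univ, true_and, not_lt] at hx
      refine le_trans ?_ (card_unbalanced_le hΔ {x' | c x' = c x} ⟨x, by simp⟩
        (by positivity) hx)
      exact_mod_cast card_le_card (filter_subset_filter _ (subset_univ I))
  push_cast
  refine (sum_le_sum fun x _ ↦ hterm x).trans ?_
  rw [sum_add_distrib, sum_const, nsmul_eq_mul, card_univ, hcardq, ← sum_filter, sum_const,
    nsmul_eq_mul]
  gcongr

end Cube

/-! ### Lost edges -/

section Lost

open Finset

lemma card_filter_apply_mem {V Q : Type*} [Fintype V] [DecidableEq V] [Fintype Q] [DecidableEq Q]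
    (a : V) (S : Finset Q) :
    #{t : V → Q | t a ∈ S} * Fintype.card Q = #S * Fintype.card Q ^ Fintype.card V := by
  have h : ({t : V → Q | t a ∈ S} : Finset (V → Q)) =
      Fintype.piFinset fun c ↦ if c = a then S else univ := by
    ext t
    simp only [mem_filter, mem_univ, true_and, Fintype.mem_piFinset]
    constructor
    · intro ht c
      split_ifs with hc
      · exact hc ▸ ht
      · exact mem_univ _
    · intro ht
      simpa using ht a
  have h1 : Fintype.card Q = ∏ c, if c = a then Fintype.card Q else 1 := by simp
  have h2 : #S = ∏ c, if c = a then #S else 1 := by simp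
  rw [h, Fintype.card_piFinset]
  conv_lhs => rw [h1]
  conv_rhs => rw [h2]
  rw [← card_univ (α := V), ← prod_const, ← prod_mul_distrib, ← prod_mul_distrib]
  refine prod_congr rfl fun c _ ↦ ?_
  split_ifs <;> simp

lemma card_filter_apply_pair_mem {V Q : Type*} [Fintype V] [DecidableEq V] [Fintype Q]
    [DecidableEq Q] {a b : V} (hab : a ≠ b) (R : Finset (Q × Q)) :
    #{t : V → Q | (t a, t b) ∈ R} * Fintype.card Q ^ 2 =
      #R * Fintype.card Q ^ Fintype.card V := by
  have hfib (p : Q × Q) : #{t : V → Q | (t a, t b) = p} * Fintype.card Q ^ 2 =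
      Fintype.card Q ^ Fintype.card V := by
    have h : ({t : V → Q | (t a, t b) = p} : Finset (V → Q)) =
        Fintype.piFinset fun c ↦ if c = a then {p.1} else if c = b then {p.2} else univ := by
      ext t
      simp only [mem_filter, mem_univ, true_and, Fintype.mem_piFinset]
      constructor
      · rintro rfl c
        split_ifs with hc hc'
        · simp [hc]
        · simp [hc']
        · exact mem_univ _
      · intro ht
        have h1 := ht a
        have h2 := ht b
        rw [if_pos rfl, mem_singleton] at h1
        rw [if_neg hab.symm, if_pos rfl, mem_singleton] at h2
        exact Prod.ext h1 h2
    have h1 (d : V) : Fintype.card Q = ∏ c, if c = d then Fintype.card Q else 1 := by simp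
    rw [h, Fintype.card_piFinset]
    calc _ = (∏ c, #(if c = a then {p.1} else if c = b then {p.2} else univ)) *
          ((∏ c, if c = a then Fintype.card Q else 1) *
            ∏ c, if c = b then Fintype.card Q else 1) := by rw [← h1 a, ← h1 b, sq]
      _ = ∏ c : V, Fintype.card Q := by
        rw [← prod_mul_distrib, ← prod_mul_distrib]
        refine prod_congr rfl fun c _ ↦ ?_
        by_cases hc : c = a
        · subst hc
          simp [hab]
        · by_cases hc' : c = b
          · subst hc'
            simp [hab.symm]
          · simp [hc, hc']
      _ = _ := by simp
  rw [card_eq_sum_card_fiberwise (f := fun t : V → Q ↦ (t a, t b)) (t := R)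
    (by intro t ht; simpa using ht), sum_mul, card_eq_sum_ones, sum_mul]
  refine sum_congr rfl fun p hp ↦ ?_
  rw [one_mul, ← hfib p]
  congr 2
  ext t
  simp only [mem_filter, mem_univ, true_and, and_iff_right_iff_imp]
  exact fun h ↦ h ▸ hp

variable {V : Type*} [Fintype V] {F : SimpleGraph V}

open Classical in
/-- Colour the cubes at the vertices of a copy of `F`, and let `Γ` be a graph on the colours that
has no homomorphism from `F`. If the `t a` are random points of the cubes, then some edge `ab` of
`F` is not respected by the colours of `t a` and `t b`. Where the colour classes are balanced at
the coordinate `C`, this loses all edges between two large pieces of the classes. -/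
lemma exists_adj_card_lost {ι : Type*} [Fintype ι] {Δ k : ℕ} (hΔ : 0 < Δ)
    {Γ : SimpleGraph (Fin k)} (hΓ : HomFree F Γ) (c : V → (ι → Fin Δ) → Fin k) (C : ι)
    (lab : V → V → Fin Δ) (hF : ∃ a b, F.Adj a b) :
    ∃ a b, F.Adj a b ∧ (Δ ^ Fintype.card ι) ^ 2 ≤
      Δ ^ Fintype.card ι * ∑ v, #{x | ¬ Balanced {x' | c v x' = c v x} C} +
      4 * Δ ^ 2 * Fintype.card V ^ 2 * #{p : (ι → Fin Δ) × (ι → Fin Δ) |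
        p.1 C = lab a b ∧ p.2 C = lab b a ∧ ¬ Γ.Adj (c a p.1) (c b p.2)} := by
  set q := Δ ^ Fintype.card ι with hq
  have hcard : Fintype.card (ι → Fin Δ) = q := by simp [hq]
  have hq0 : 0 < q := pow_pos hΔ _
  set R : V × V → Finset ((ι → Fin Δ) × (ι → Fin Δ)) := fun e ↦
    {p | Balanced {x' | c e.1 x' = c e.1 p.1} C ∧ Balanced {x' | c e.2 x' = c e.2 p.2} C ∧
      ¬ Γ.Adj (c e.1 p.1) (c e.2 p.2)} with hR
  set L : V × V → Finset ((ι → Fin Δ) × (ι → Fin Δ)) := fun e ↦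
    {p | p.1 C = lab e.1 e.2 ∧ p.2 C = lab e.2 e.1 ∧ ¬ Γ.Adj (c e.1 p.1) (c e.2 p.2)} with hL
  have hRL (e : V × V) : #(R e) ≤ 4 * Δ ^ 2 * #(L e) := by
    rw [card_eq_sum_card_fiberwise (f := fun p ↦ (c e.1 p.1, c e.2 p.2)) (t := univ)
      (fun _ _ ↦ mem_univ _), card_eq_sum_card_fiberwise (s := L e)
      (f := fun p ↦ (c e.1 p.1, c e.2 p.2)) (t := univ) (fun _ _ ↦ mem_univ _), mul_sum]
    refine sum_le_sum fun γ _ ↦ ?_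
    rcases ({p ∈ R e | (c e.1 p.1, c e.2 p.2) = γ} : Finset _).eq_empty_or_nonempty with h | h
    · simp [h]
    · obtain ⟨⟨x₀, y₀⟩, h₀⟩ := h
      simp only [hR, mem_filter, mem_univ, true_and] at h₀
      obtain ⟨⟨hb1, hb2, hadj⟩, rfl⟩ := h₀
      set P₁ : Finset (ι → Fin Δ) := {x' | c e.1 x' = c e.1 x₀} with hP₁
      set P₂ : Finset (ι → Fin Δ) := {x' | c e.2 x' = c e.2 y₀} with hP₂
      calc _ ≤ #(P₁ ×ˢ P₂) := card_le_card fun p hp ↦ by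
            have := (mem_filter.1 hp).2
            rw [Prod.mk.injEq] at this
            rw [mem_product, hP₁, hP₂, mem_filter, mem_filter]
            exact ⟨⟨mem_univ _, this.1⟩, mem_univ _, this.2⟩
        _ ≤ (2 * Δ * #{x ∈ P₁ | x C = lab e.1 e.2}) * (2 * Δ * #{x ∈ P₂ | x C = lab e.2 e.1}) := by
            rw [card_product]
            exact Nat.mul_le_mul (hb1 _) (hb2 _)
        _ = 4 * Δ ^ 2 * #({x ∈ P₁ | x C = lab e.1 e.2} ×ˢ {x ∈ P₂ | x C = lab e.2 e.1}) := by
            rw [card_product]; ring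
        _ ≤ _ := by
            refine Nat.mul_le_mul_left _ (card_le_card fun p hp ↦ ?_)
            simp only [hP₁, hP₂, mem_product, mem_filter, mem_univ, true_and] at hp
            obtain ⟨⟨h1, h2⟩, h3, h4⟩ := hp
            simp only [hL, mem_filter, mem_univ, true_and, Prod.mk.injEq]
            exact ⟨⟨h2, h4, by rwa [h1, h3]⟩, h1, h3⟩
  set 𝓔 : Finset (V × V) := {e | F.Adj e.1 e.2} with h𝓔
  have hcover : (univ : Finset (V → ι → Fin Δ)) ⊆
      (univ.biUnion fun v ↦ {t | t v ∈ ({x | ¬ Balanced {x' | c v x' = c v x} C} : Finset _)}) ∪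
      𝓔.biUnion fun e ↦ {t | (t e.1, t e.2) ∈ R e} := by
    intro t _
    by_contra ht
    simp only [mem_union, mem_biUnion, mem_filter, mem_univ, true_and, not_or, not_exists,
      not_not, hR, h𝓔, not_and] at ht
    exact hΓ.false ⟨fun v ↦ c v (t v), fun {a b} hab ↦ ht.2 (a, b) hab (ht.1 a) (ht.1 b)⟩
  have hcount : q ^ 2 ≤
      q * ∑ v, #{x | ¬ Balanced {x' | c v x' = c v x} C} + ∑ e ∈ 𝓔, #(R e) := by
    have h1 := card_le_card hcover
    rw [card_univ, Fintype.card_fun, hcard] at h1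
    have h2 := h1.trans ((card_union_le _ _).trans
      (Nat.add_le_add card_biUnion_le card_biUnion_le))
    refine Nat.le_of_mul_le_mul_right ?_ (pow_pos hq0 (Fintype.card V))
    calc q ^ 2 * q ^ Fintype.card V = q ^ Fintype.card V * q ^ 2 := mul_comm _ _
      _ ≤ _ := Nat.mul_le_mul_right _ h2
      _ = _ := by
        rw [add_mul, add_mul]
        refine congrArg₂ (· + ·) ?_ ?_
        · rw [mul_sum, sum_mul, sum_mul]
          refine sum_congr rfl fun v _ ↦ ?_
          have := card_filter_apply_mem v
            ({x | ¬ Balanced {x' | c v x' = c v x} C} : Finset (ι → Fin Δ))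
          rw [hcard] at this
          rw [sq, ← mul_assoc, this]
          ring
        · rw [sum_mul, sum_mul]
          refine sum_congr rfl fun e he ↦ ?_
          have := card_filter_apply_pair_mem (F.ne_of_adj (mem_filter.1 he).2) (R e)
          rwa [hcard] at this
  have hne : 𝓔.Nonempty := by
    obtain ⟨a, b, hab⟩ := hF
    exact ⟨(a, b), by simpa [h𝓔] using hab⟩
  obtain ⟨e, he, hmax⟩ := exists_max_image 𝓔 (fun e ↦ #(R e)) hne
  refine ⟨e.1, e.2, (mem_filter.1 he).2, hcount.trans (Nat.add_le_add_left ?_ _)⟩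
  calc ∑ e' ∈ 𝓔, #(R e') ≤ #𝓔 * #(R e) := sum_le_card_nsmul 𝓔 (fun e ↦ #(R e)) _ hmax
    _ ≤ Fintype.card V ^ 2 * (4 * Δ ^ 2 * #(L e)) :=
        Nat.mul_le_mul ((card_le_univ _).trans (by simp [sq])) (hRL e)
    _ = _ := by ring

end Lost

section Lost

open Finset

variable {V : Type*} [Fintype V] {F : SimpleGraph V}

open Classical in
/-- The random point at a random vertex of a random copy is typically in a colour class that is
balanced at the coordinate of this copy, provided that the number of copies per vertex is large
in terms of the logarithm of the number of colours. -/
lemma sum_unbalanced_le {ι X : Type*} [Fintype ι] [Fintype X] {Δ k : ℕ} (hΔ : 0 < Δ)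
    (hV : 1 ≤ Fintype.card V) (j : ι → V ↪ X) (f : X × (ι → Fin Δ) → Fin k)
    (hlog : 32 * Δ * Fintype.card X * Real.log (4 * Fintype.card V * k) ≤ Fintype.card ι) :
    ((∑ C, ∑ v, #{x | ¬ Balanced {x' | f (j C v, x') = f (j C v, x)} C} : ℕ) : ℝ) ≤
      (Δ : ℝ) ^ Fintype.card ι * (Fintype.card ι / 2) := by
  set r := Fintype.card V
  set m := Fintype.card ι
  set I : X → Finset ι := fun u ↦ {C | u ∈ univ.map (j C)} with hI
  have hr : (1 : ℝ) ≤ r := by exact_mod_cast hV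
  have hswap : ∑ C, ∑ v, #{x | ¬ Balanced {x' | f (j C v, x') = f (j C v, x)} C} =
      ∑ u, ∑ x, #{C ∈ I u | ¬ Balanced {x' | f (u, x') = f (u, x)} C} := by
    calc _ = ∑ C, ∑ u ∈ univ.map (j C), #{x | ¬ Balanced {x' | f (u, x') = f (u, x)} C} :=
          sum_congr rfl fun C _ ↦ by rw [sum_map]
      _ = ∑ u, ∑ C ∈ I u, #{x | ¬ Balanced {x' | f (u, x') = f (u, x)} C} :=
          sum_comm' fun C u ↦ by simp [hI]
      _ = _ := sum_congr rfl fun u _ ↦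
          sum_card_bipartiteAbove_eq_sum_card_bipartiteBelow
            fun C x ↦ ¬ Balanced {x' | f (u, x') = f (u, x)} C
  have hI' : ∑ u, #(I u) = m * r := by
    calc _ = ∑ C, #(univ.map (j C)) := by
          refine (sum_card_bipartiteAbove_eq_sum_card_bipartiteBelow (s := univ) (t := univ)
            fun C u ↦ u ∈ univ.map (j C)).symm.trans (sum_congr rfl fun C _ ↦ ?_)
          simp only [bipartiteAbove, filter_univ_mem]
      _ = _ := by simp [m, r]
  have hI'' : (∑ u, (#(I u) : ℝ)) = m * r := by exact_mod_cast hI'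
  rw [hswap]
  push_cast
  -- With `K = 4 r`, the `r` vertices of the copies contribute `m / 4` through small colour classes.
  have key (u : X) := sum_card_unbalanced_le hΔ (fun x ↦ f (u, x)) (I u) (K := 4 * r)
    (by linarith)
  push_cast at key
  refine (sum_le_sum fun u _ ↦ key u).trans ?_
  rw [sum_add_distrib, sum_const, nsmul_eq_mul, card_univ, ← mul_sum, hI'']
  have hq : (0 : ℝ) ≤ (Δ : ℝ) ^ m := by positivity
  have h1 : (Δ : ℝ) ^ m / (4 * r) * (m * r) = (Δ : ℝ) ^ m * (m / 4) := by field_simp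
  rw [h1]
  nlinarith

/-- An `ε`-approximate homomorphism from the star of a linear family of many copies of `F` to an
`F`-hom-free graph with few vertices loses a constant proportion of the edges. -/
theorem card_le_of_isApproxHom [DecidableRel F.Adj] (o : EdgeOrdering F)
    (hF : ∃ a b, F.Adj a b) {ι X : Type*} [Fintype ι] [Fintype X] [DecidableEq X]
    (j : ι → V ↪ X)
    (hlin : ∀ C C', C ≠ C' → #(univ.map (j C) ∩ univ.map (j C')) ≤ 1) {k : ℕ}
    {Γ : SimpleGraph (Fin k)} (hΓ : HomFree F Γ) {f : X × (ι → Fin F.maxDegree) → Fin k} {ε : ℝ}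
    (hf : IsApproxHom (familyStar F o j) Γ ε f)
    (hlog : 32 * F.maxDegree * Fintype.card X * Real.log (4 * Fintype.card V * k) ≤
      Fintype.card ι) :
    (Fintype.card ι : ℝ) ≤
      8 * F.maxDegree ^ 2 * Fintype.card V ^ 2 * ε * Fintype.card X ^ 2 := by
  classical
  have hlt (a b : V) (h : F.Adj a b) : (o a ⟨b, h⟩ : ℕ) < F.maxDegree :=
    (o a ⟨b, h⟩).is_lt.trans_le (F.degree_le_maxDegree a)
  have hΔ : 0 < F.maxDegree := by
    obtain ⟨a, b, h⟩ := hF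
    exact (Nat.zero_le _).trans_lt (hlt a b h)
  have hV : 1 ≤ Fintype.card V := Fintype.card_pos_iff.2 ⟨hF.choose⟩
  have hB := sum_unbalanced_le hΔ hV j f hlog
  let lab (a b : V) : Fin F.maxDegree := if h : F.Adj a b then ⟨o a ⟨b, h⟩, hlt a b h⟩ else ⟨0, hΔ⟩
  have hlab {a b : V} (h : F.Adj a b) : (lab a b : ℕ) = o a ⟨b, h⟩ := by simp [lab, h]
  choose a b hab hmany using fun C ↦
    exists_adj_card_lost hΔ hΓ (fun v x ↦ f (j C v, x)) C lab hF
  set L : ι → Finset ((ι → Fin F.maxDegree) × (ι → Fin F.maxDegree)) := fun C ↦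
    {p | p.1 C = lab (a C) (b C) ∧ p.2 C = lab (b C) (a C) ∧
      ¬ Γ.Adj (f (j C (a C), p.1)) (f (j C (b C), p.2))} with hL
  -- Every lost edge is counted once, because two copies share at most one vertex.
  have hlost : ∑ C, #(L C) ≤
      {e | e ∈ (familyStar F o j).edgeSet ∧ e.map f ∉ Γ.edgeSet}.ncard := by
    rw [← card_sigma, ← Finset.card_image_of_injOn
      (f := fun s : Σ _ : ι, (ι → Fin F.maxDegree) × (ι → Fin F.maxDegree) ↦
        s((j s.1 (a s.1), s.2.1), (j s.1 (b s.1), s.2.2))), ← Set.ncard_coe_finset]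
    · refine Set.ncard_le_ncard ?_ (Set.toFinite _)
      intro e he
      obtain ⟨⟨C, p⟩, hp, rfl⟩ := mem_image.1 (mem_coe.1 he)
      rw [mem_sigma] at hp
      obtain ⟨-, h1, h2, h3⟩ := by simpa only [hL, mem_filter] using hp.2
      refine ⟨?_, by simpa using h3⟩
      rw [SimpleGraph.mem_edgeSet]
      exact ⟨C, a C, b C, hab C, rfl, rfl, (congrArg Fin.val h1).trans (hlab _),
        (congrArg Fin.val h2).trans (hlab _)⟩
    · rintro ⟨C, p⟩ - ⟨C', p'⟩ - h
      simp only [Sym2.eq_iff, Prod.mk.injEq] at h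
      have hmem (D : ι) (v : V) : j D v ∈ univ.map (j D) := mem_map_of_mem _ (mem_univ v)
      obtain rfl : C = C' := by
        by_contra hne
        have hne' : j C (a C) ≠ j C (b C) := fun h ↦ (hab C).ne ((j C).injective h)
        refine hne' (card_le_one.1 (hlin C C' hne) _ (mem_inter.2 ⟨hmem _ _, ?_⟩) _
          (mem_inter.2 ⟨hmem _ _, ?_⟩))
        · rcases h with h | h <;> (rw [h.1.1]; exact hmem _ _)
        · rcases h with h | h <;> (rw [h.2.1]; exact hmem _ _)
      rcases h with h | h
      · rw [Prod.ext h.1.2 h.2.2]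
      · exact absurd ((j C).injective h.1.1) (hab C).ne
  have hsum := sum_le_sum fun C (_ : C ∈ univ) ↦ hmany C
  rw [sum_const, smul_eq_mul, card_univ, sum_add_distrib, ← mul_sum, ← mul_sum] at hsum
  have hcast (m q b l d r : ℕ) (h : m * q ^ 2 ≤ q * b + 4 * d ^ 2 * r ^ 2 * l) :
      (m : ℝ) * q ^ 2 ≤ q * b + 4 * d ^ 2 * r ^ 2 * l := by exact_mod_cast h
  have hsum' : (Fintype.card ι : ℝ) * (F.maxDegree ^ Fintype.card ι) ^ 2 ≤ F.maxDegree ^ Fintype.card ι *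
      ((∑ C, ∑ v, #{x | ¬ Balanced {x' | f (j C v, x') = f (j C v, x)} C} : ℕ) : ℝ) +
        4 * F.maxDegree ^ 2 * Fintype.card V ^ 2 * ((∑ C, #(L C) : ℕ) : ℝ) := by
    simpa only [Nat.cast_pow] using hcast _ _ _ _ _ _ hsum
  have hf' : ((∑ C, #(L C) : ℕ) : ℝ) ≤
      ε * (Fintype.card X * (F.maxDegree : ℝ) ^ Fintype.card ι) ^ 2 := by
    refine le_trans (Nat.cast_le.2 hlost) (hf.trans_eq ?_)
    simp [Nat.card_eq_fintype_card]
  have hq : (0 : ℝ) < (F.maxDegree : ℝ) ^ Fintype.card ι := pow_pos (by exact_mod_cast hΔ) _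
  generalize (F.maxDegree : ℝ) ^ Fintype.card ι = q at hsum' hf' hB hq
  have h1 : (Fintype.card ι : ℝ) * q ^ 2 ≤ q * (q * (Fintype.card ι / 2)) +
      4 * F.maxDegree ^ 2 * Fintype.card V ^ 2 * (ε * (Fintype.card X * q) ^ 2) := by
    refine hsum'.trans (add_le_add ?_ ?_)
    · exact mul_le_mul_of_nonneg_left hB hq.le
    · exact mul_le_mul_of_nonneg_left hf' (by positivity)
  refine le_of_mul_le_mul_right ?_ (pow_pos hq 2)
  linarith

end Lost

/-! ### The choice of the parameters -/

section Main

open Finset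

/-- The lower bound on the number of vertices that comes from a sparse hypergraph of maximum
degree `D`. -/
lemma exp_le_of_approxHomBound {V W : Type*} [Fintype V] [Finite W]
    (F : SimpleGraph V) [DecidableRel F.Adj] (H : SimpleGraph W)
    (hV : 2 ≤ Fintype.card V) (hF : ∃ a b, F.Adj a b)
    (o : EdgeOrdering F)
    (iso : ∀ (U : Type) (T : SimpleGraph U) (C : FCopy F T), F ≃g C.1.coe)
    (hH : ∀ (U : Type) (T : SimpleGraph U), IsFForest F T → Nonempty (T →g F) →
      IsEmpty (H →g starGraph F o T (iso U T)))
    {g D M : ℕ} (hg : Nat.card W ^ 2 ≤ g) (hg2 : 2 ≤ g) (hD : 1 ≤ D) {ε : ℝ}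
    (hε : 16 * F.maxDegree ^ 2 * Fintype.card V ^ 4 * ε *
      (2 * Fintype.card V * (1 + Fintype.card V * D) ^ (2 * g)) < D)
    (hM : ApproxHomBound F H ε M) :
    Real.exp (D / (64 * F.maxDegree * Fintype.card V)) ≤ 4 * Fintype.card V * M := by
  classical
  have hΔ : 0 < F.maxDegree := by
    obtain ⟨a, b, h⟩ := hF
    exact ((F.degree_pos_iff_exists_adj a).2 ⟨b, h⟩).trans_le (F.degree_le_maxDegree a)
  set r := Fintype.card V with hr
  set Δ := F.maxDegree
  set n := 2 * r * (1 + r * D) ^ (2 * g) with hn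
  have hn0 : 0 < n := by positivity
  obtain ⟨𝓗, hsp, hcard⟩ := exists_sparse_family (r := r) (n := n) (D := D) (g := g) hV (by omega)
  have hcard' : D * n ≤ 2 * #𝓗 := by
    have : D * n = 2 * (D * (r * (1 + r * D) ^ (2 * g))) := by rw [hn]; ring
    omega
  let φ : V ≃ Fin r := Fintype.equivFin V
  let j (C : 𝓗) : V ↪ Fin r × Fin n :=
    ⟨fun a ↦ (φ a, C.1 (φ a)), fun a b h ↦ φ.injective (congrArg Prod.fst h)⟩
  have hj (C : 𝓗) : univ.map (j C) = graphEdge C.1 := by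
    ext x
    rw [mem_graphEdge]
    simp only [mem_map, mem_univ, true_and]
    constructor
    · rintro ⟨a, rfl⟩; rfl
    · intro h
      refine ⟨φ.symm x.1, Prod.ext (φ.apply_symm_apply _) ?_⟩
      change C.1 (φ (φ.symm x.1)) = x.2
      rwa [φ.apply_symm_apply]
  have hsp' : SparseUpTo (fun C : 𝓗 ↦ univ.map (j C)) r g univ := by
    intro 𝓢 _ hne h𝓢
    have := hsp (𝓢.image Subtype.val) (fun C hC ↦ by
      obtain ⟨C', -, rfl⟩ := mem_image.1 hC
      exact C'.2) (hne.image _) (card_image_le.trans h𝓢)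
    rw [card_image_of_injective _ Subtype.val_injective, image_biUnion] at this
    simpa only [hj] using this
  have : Nonempty 𝓗 := by
    have : 0 < D * n := by positivity
    obtain ⟨C, hC⟩ := card_pos.1 (show 0 < #𝓗 by omega)
    exact ⟨⟨C, hC⟩⟩
  have hfree : HomFree H (familyStar F o j) := by
    refine ⟨fun ψ ↦ ?_⟩
    obtain ⟨U, T, hT, hTF, ⟨χ⟩⟩ := exists_forest_of_hom_familyStar F H o hΔ iso hV j
      (fun x ↦ φ.symm x.1) (fun C a ↦ φ.symm_apply_apply a) hg hg2 hsp' ψ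
    exact (hH U T hT hTF).false χ
  obtain ⟨k, Γ, f, hkM, hΓ, hf⟩ := hM _ (familyStar F o j) hfree
  have hr0 : (0 : ℝ) < r := by exact_mod_cast (by omega : 0 < r)
  have hΔ0 : (0 : ℝ) < Δ := by exact_mod_cast hΔ
  have hn0' : (0 : ℝ) < n := by exact_mod_cast hn0
  have hm : (D : ℝ) * n ≤ 2 * Fintype.card 𝓗 := by
    rw [Fintype.card_coe]
    exact_mod_cast hcard'
  have hX : (Fintype.card (Fin r × Fin n) : ℝ) = r * n := by simp
  have hlog : (D : ℝ) / (64 * Δ * r) < Real.log (4 * r * k) := by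
    by_contra! hle
    have h1 := card_le_of_isApproxHom o hF j
      (fun C C' hne ↦ hsp'.card_inter_le_one (by simp [hr]) hg2 (mem_univ C) (mem_univ C') hne)
      hΓ hf (by
        rw [hX]
        rw [le_div_iff₀ (by positivity)] at hle
        nlinarith)
    rw [hX] at h1
    have h2 : (D : ℝ) * n ≤ 16 * Δ ^ 2 * r ^ 4 * ε * n * n := by
      refine hm.trans ((mul_le_mul_of_nonneg_left h1 zero_le_two).trans_eq ?_)
      ring
    have h3 := le_of_mul_le_mul_right h2 hn0'
    rw [hn] at h3
    push_cast at h3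
    linarith
  have hk : (0 : ℝ) < k := by
    rcases Nat.eq_zero_or_pos k with rfl | hk
    · have : 0 ≤ (D : ℝ) / (64 * Δ * r) := by positivity
      simp only [Nat.cast_zero, mul_zero, Real.log_zero] at hlog
      linarith
    · exact_mod_cast hk
  calc Real.exp (D / (64 * Δ * r)) ≤ 4 * r * k :=
        (Real.le_log_iff_exp_le (by positivity)).1 hlog.le
    _ ≤ 4 * r * M := by gcongr

/-- The choice `D ≈ (1 / ε) ^ (1 / (2 g))` of the degree in terms of `ε`. -/
lemma exists_degree {r Δ g : ℕ} (hr : 1 ≤ r) (hΔ : 1 ≤ Δ) (hg : 1 ≤ g) :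
    ∃ c : ℝ, 0 < c ∧ ∃ ε₀ : ℝ, 0 < ε₀ ∧ ∀ ε : ℝ, 0 < ε → ε < ε₀ → ∃ D : ℕ, 1 ≤ D ∧
      16 * Δ ^ 2 * r ^ 4 * ε * (2 * r * (1 + r * D) ^ (2 * g)) < D ∧
      4 * r * (2 : ℝ) ^ ((1 / ε) ^ c) ≤ Real.exp (D / (64 * Δ * r)) := by
  have hr' : (1 : ℝ) ≤ r := by exact_mod_cast hr
  have hΔ' : (1 : ℝ) ≤ Δ := by exact_mod_cast hΔ
  have hg' : (1 : ℝ) ≤ g := by exact_mod_cast hg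
  set A : ℝ := 32 * Δ ^ 2 * r ^ 5 * (2 * r) ^ (2 * g) with hA
  set B : ℝ := 64 * Δ * r with hB
  have hA0 : 0 < A := by positivity
  have hB0 : 0 < B := by positivity
  set t₀ : ℝ := A + B * (4 * r + 1) + 2 with ht₀
  have ht₀pos : 0 < t₀ := by positivity
  refine ⟨1 / (4 * g : ℕ), by positivity, (t₀ ^ (4 * g))⁻¹, by positivity, fun ε hε hε₀ ↦ ?_⟩
  set t : ℝ := (1 / ε) ^ (1 / (4 * g : ℕ) : ℝ) with ht
  have htpow : t ^ (4 * g) = 1 / ε := by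
    rw [ht, one_div ((4 * g : ℕ) : ℝ)]
    exact Real.rpow_inv_natCast_pow (by positivity) (by omega)
  have htpos : 0 < t := by positivity
  have htt₀ : t₀ < t := by
    refine lt_of_pow_lt_pow_left₀ (4 * g) htpos.le ?_
    rw [htpow, one_div]
    exact (lt_inv_comm₀ hε (by positivity)).1 hε₀
  have ht1 : 1 ≤ t := by nlinarith [mul_pos hB0 (by positivity : (0 : ℝ) < 4 * r + 1)]
  set D := ⌊t ^ 2⌋₊ with hD
  have hD1 : (D : ℝ) ≤ t ^ 2 := Nat.floor_le (by positivity)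
  have hD2 : t ^ 2 - 1 < D := Nat.sub_one_lt_floor _
  have hAD : A + 1 < D := by
    have : t ≤ t ^ 2 := by nlinarith
    have : 0 < B * (4 * r + 1) := by positivity
    linarith
  have hDpos : 1 ≤ D := by
    have : (0 : ℝ) < D := by linarith
    exact_mod_cast this
  have hDpos' : (1 : ℝ) ≤ D := by exact_mod_cast hDpos
  refine ⟨D, hDpos, ?_, ?_⟩
  · have h1 : (D : ℝ) ^ (2 * g) * ε ≤ 1 := by
      rw [← le_div_iff₀ hε, ← htpow, show 4 * g = 2 * (2 * g) by ring, pow_mul t 2 (2 * g)]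
      exact pow_le_pow_left₀ (by positivity) hD1 _
    have h2 : (1 + r * D : ℝ) ^ (2 * g) ≤ (2 * r) ^ (2 * g) * D ^ (2 * g) := by
      rw [← mul_pow]
      refine pow_le_pow_left₀ (by positivity) ?_ _
      nlinarith
    calc 16 * Δ ^ 2 * r ^ 4 * ε * (2 * r * (1 + r * D) ^ (2 * g))
        ≤ 16 * Δ ^ 2 * r ^ 4 * ε * (2 * r * ((2 * r) ^ (2 * g) * D ^ (2 * g))) := by gcongr
      _ = A * (D ^ (2 * g) * ε) := by rw [hA]; ring
      _ ≤ A * 1 := by gcongr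
      _ < D := by linarith
  · have h1 : (4 * r : ℝ) ≤ Real.exp (4 * r) := by
      linarith [Real.add_one_le_exp (4 * r : ℝ)]
    have h2 : (2 : ℝ) ^ t ≤ Real.exp t := by
      rw [← Real.exp_one_rpow]
      refine Real.rpow_le_rpow (by norm_num) ?_ htpos.le
      linarith [Real.add_one_le_exp (1 : ℝ)]
    calc 4 * r * (2 : ℝ) ^ t ≤ Real.exp (4 * r) * Real.exp t := by gcongr
      _ = Real.exp (4 * r + t) := (Real.exp_add _ _).symm
      _ ≤ _ := by
        refine Real.exp_le_exp.2 ((le_div_iff₀ hB0).2 ?_)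
        have h3 : t * (B * (4 * r + 1) + 1) ≤ t ^ 2 := by nlinarith
        have h4 : B * (4 * r) ≤ t * (B * (4 * r)) := le_mul_of_one_le_left (by positivity) ht1
        nlinarith

end Main

end AsymHom

theorem theorem1p10 {V W : Type*} [Fintype V] [Finite W]
    (F : SimpleGraph V) [DecidableRel F.Adj] (H : SimpleGraph W)
    (hHF : Nonempty (H →g F)) (hF : AsymHom.TwoConnected F)
    (o : AsymHom.EdgeOrdering F)
    (iso : ∀ (U : Type) (T : SimpleGraph U) (C : AsymHom.FCopy F T), F ≃g C.1.coe)
    (hH : ∀ (U : Type) (T : SimpleGraph U), AsymHom.IsFForest F T → Nonempty (T →g F) →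
      IsEmpty (H →g AsymHom.starGraph F o T (iso U T))) :
    ∃ c : ℝ, 0 < c ∧ ∃ ε₀ : ℝ, 0 < ε₀ ∧ ∀ ε : ℝ, 0 < ε → ε < ε₀ →
      ENNReal.ofReal ((2 : ℝ) ^ ((1 / ε) ^ c)) ≤ (AsymHom.approxHomNumber F H ε : ℝ≥0∞) := by
  have hV : 3 ≤ Fintype.card V := hF.1
  have : Nontrivial V := Fintype.one_lt_card_iff_nontrivial.1 (by omega)
  have hadj : ∃ a b, F.Adj a b :=
    ⟨_, hF.2.1.preconnected.exists_adj_of_nontrivial (Classical.arbitrary V)⟩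
  have hΔ : 0 < F.maxDegree := by
    obtain ⟨a, b, h⟩ := hadj
    exact ((F.degree_pos_iff_exists_adj a).2 ⟨b, h⟩).trans_le (F.degree_le_maxDegree a)
  obtain ⟨c, hc, ε₀, hε₀, hparam⟩ := AsymHom.exists_degree (r := Fintype.card V)
    (Δ := F.maxDegree) (g := Nat.card W ^ 2 + 2) (by omega) hΔ (by omega)
  refine ⟨c, hc, ε₀, hε₀, fun ε hε hlt ↦ ?_⟩
  obtain ⟨D, hD, hDε, hDexp⟩ := hparam ε hε hlt
  have key : (⌈(2 : ℝ) ^ ((1 / ε) ^ c)⌉₊ : ℕ∞) ≤ AsymHom.approxHomNumber F H ε := by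
    refine le_iInf₂ fun M hM ↦ Nat.cast_le.2 (Nat.ceil_le.2 ?_)
    have h := hDexp.trans (AsymHom.exp_le_of_approxHomBound F H (by omega) hadj o iso hH
      (by omega) (by omega) hD hDε hM)
    have hr : (0 : ℝ) < 4 * Fintype.card V := by
      have : (3 : ℝ) ≤ Fintype.card V := by exact_mod_cast hV
      linarith
    exact le_of_mul_le_mul_left h hr
  calc ENNReal.ofReal ((2 : ℝ) ^ ((1 / ε) ^ c))
      ≤ ((⌈(2 : ℝ) ^ ((1 / ε) ^ c)⌉₊ : ℕ∞) : ℝ≥0∞) := by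
        rw [ENat.toENNReal_coe]
        exact ENNReal.ofReal_le_of_le_toReal (by simpa using Nat.le_ceil _)
    _ ≤ _ := ENat.toENNReal_le.2 key
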